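/- **Setting.** Let $Q$ be a smooth finite-dimensional manifold and $G$ a Lie group acting smoothly on $Q$ from the left so that $\pi:Q\to Q/G$ is a smooth principal $G$-bundle. Write $\mathcal V^G_q=T_q(Gq)$. A *discrete mechanical system* $(Q,L_d,\mathcal D,\mathcal D_d)$ consists of a smooth $L_d:Q\times Q\to\mathbb R$, a subbundle $\mathcal D\subset TQ$ and a submanifold $\mathcal D_d\subset Q\times Q$. A discrete curve $q_\cdot:\{0,\dots,N\}\to Q$ is a *trajectory* if $(q_k,q_{k+1})\in\mathcal D_d$ for $0\le k<N$ and $$\sum_{k=0}^{N-1}dL_d(q_k,q_{k+1})(\delta q_k,\delta q_{k+1})=0$$ for all $\delta q_k\in\mathcal D_{q_k}$ $(0\le k\le N)$ with $\delta q_0=0$, $\delta q_N=0$. With a discrete force $f_d$ (a $1$-form on $Q\times Q$) the sum is replaced by $\sum_{k}\big(dL_d(q_k,q_{k+1})+f_d(q_k,q_{k+1})\big)(\delta q_k,\delta q_{k+1})$. **Chaplygin symmetry.** Assume that $G$ is a symmetry group: $L_d$ and $\mathcal D_d$ are invariant under the diagonal action and $\mathcal D$ under the lifted action. Assume that it is of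 Chaplygin type: $TQ=\mathcal V^G\oplus\mathcal D$, and $\mathcal D_d$ defines an affine discrete connection, that is: * there is a smooth $\gamma:Q\to G$ with $\gamma(gq)=g\gamma(q)g^{-1}$ and $(q,\gamma(q)q)\in\mathcal D_d$; * $\mathcal D_d^2(q)=\{q_1:(q,q_1)\in\mathcal D_d\}$ is a submanifold of $Q$ and $T_{q_1}Q=T_{q_1}(Gq)\oplus T_{q_1}\mathcal D_d^2(q)$ for all $q_1\in Gq\cap\mathcal D_d^2(q)$; * for every $(q_0,q_1)\in Q\times Q$ there is at most one $g=:\mathcal A_d(q_0,q_1)\in G$ with $(q_0,g^{-1}q_1)\in\mathcal D_d$; the set of pairs for which it exists is open (it may be all of $Q\times Q$), and $\mathcal A_d$ is smooth on it. The discrete horizontal lift $h_{q_0}(r_1)$ is the unique $q_1$ with $(q_0,q_1)\in\mathcal D_d$ and $\pi(q_1)=r_1$, when it exists. For $w\in T_{\pi(q)}(Q/G)$ let $h^q(w)\in\mathcal D_q$ be the vector with $d\pi(q)(h^q(w))=w$. **Reduced system on $Q/G$.** Put $\check L_d(q_0,w_0,r_1)=L_d\big(q_0,w_0h_{q_0}(r_1)\big)$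 for $w_0\in G$. For any $q_0\in\pi^{-1}(r_0)$ and $q_1=h_{q_0}(r_1)$, let $$\breve L_d(r_0,r_1)=\check L_d(q_0,e,r_1),\qquad \breve F_d(r_0,r_1)(\delta r_0,\delta r_1)=D_2\check L_d(q_0,e,r_1)\Big(d\mathcal A_d(q_0,q_1)\big(h^{q_0}(\delta r_0),h^{q_1}(\delta r_1)\big)\Big),$$ $\breve{\mathcal D}_{r_0}=d\pi(q_0)(\mathcal D_{q_0})$, and let $\breve{\mathcal D}_d$ be the set of $(r_0,r_1)$ for which $h_{q_0}(r_1)$ exists (all of $(Q/G)\times(Q/G)$ if $\mathcal A_d$ is defined everywhere). **Theorem.** Let $(\bar q_0,\bar q_1)\in\mathcal D_d$, let $N\ge1$, and let $r_\cdot:\{0,\dots,N\}\to Q/G$ be a trajectory of the forced discrete mechanical system $(Q/G,\breve L_d,\breve{\mathcal D},\breve{\mathcal D}_d,\breve F_d)$ with $\pi(\bar q_j)=r_j$ for $j=0,1$. Define $q_\cdot$ by $q_0=\bar q_0$ and $q_{k+1}=h_{q_k}(r_{k+1})$ for $0\le k<N$. Then $q_\cdot$ is a trajectory of $(Q,L_d,\mathcal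 D,\mathcal D_d)$, and $q_j=\bar q_j$ for $j=0,1$. -/

import Mathlib

open scoped Manifold ContDiff Topology

noncomputable section

namespace DiscreteReduction

/-! ### Submanifolds and subbundles -/

section Submanifolds

variable {E H M : Type*} [NormedAddCommGroup E] [NormedSpace ℝ E] [TopologicalSpace H]
  (I : ModelWithCorners ℝ E H) [TopologicalSpace M] [ChartedSpace H M]

/-- `S` is an embedded submanifold of the manifold `M`: around each of its points there is a smooth
chart of `M` in which `S` is a linear subspace of the model vector space. -/
def IsSubmanifold (S : Set M) : Prop :=
  ∀ x ∈ S, ∃ φ ∈ IsManifold.maximalAtlas I ∞ M, x ∈ φ.source ∧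
    ∃ F : Submodule ℝ E, ∀ y ∈ φ.source, y ∈ S ↔ I (φ y) ∈ F

/-- The tangent space `T_x S ⊆ T_x M` of a submanifold `S` of `M`: the space of velocities at time
`0` of smooth curves of `M` that pass through `x` at time `0` and stay in `S`. -/
def submanifoldTangent (S : Set M) (x : M) : Submodule ℝ (TangentSpace I x) :=
  Submodule.span ℝ {v | ∃ c : ℝ → M, ContMDiffAt 𝓘(ℝ, ℝ) I ∞ c 0 ∧ c 0 = x ∧
    (∀ᶠ t in 𝓝 (0 : ℝ), c t ∈ S) ∧ v = (mfderiv 𝓘(ℝ, ℝ) I c 0 : ℝ →L[ℝ] E) 1}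

/-- A field of subspaces of the tangent spaces is a (smooth) subbundle of `TM`: locally it is
spanned by linearly independent smooth vector fields. -/
def IsSubbundle [IsManifold I ∞ M] (D : ∀ x : M, Submodule ℝ (TangentSpace I x)) : Prop :=
  ∀ x : M, ∃ U : Set M, IsOpen U ∧ x ∈ U ∧
    ∃ (n : ℕ) (X : Fin n → ∀ y : M, TangentSpace I y),
      (∀ i, ContMDiffOn I I.tangent ∞ (fun y => (⟨y, X i y⟩ : TangentBundle I M)) U) ∧
      ∀ y ∈ U, LinearIndependent ℝ (fun i => X i y) ∧
        Submodule.span ℝ (Set.range fun i => X i y) = D y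

end Submanifolds

/-! ### Discrete mechanical systems and their trajectories -/

section Systems

variable (E Q : Type*) [NormedAddCommGroup E] [NormedSpace ℝ E] [TopologicalSpace Q]
  [ChartedSpace E Q]

/-- A nonholonomic discrete mechanical system `(Q, L_d, 𝒟, 𝒟_d)`. -/
structure DiscreteMechanicalSystem [IsManifold 𝓘(ℝ, E) ∞ Q] where
  /-- the discrete lagrangian -/
  L : Q × Q → ℝ
  /-- the variational constraints -/
  D : ∀ q : Q, Submodule ℝ (TangentSpace 𝓘(ℝ, E) q)
  /-- the discrete kinematic constraints -/
  Dd : Set (Q × Q)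
  smooth_L : ContMDiff (𝓘(ℝ, E).prod 𝓘(ℝ, E)) 𝓘(ℝ, ℝ) ∞ L
  subbundle_D : IsSubbundle 𝓘(ℝ, E) D
  submanifold_Dd : IsSubmanifold (𝓘(ℝ, E).prod 𝓘(ℝ, E)) Dd

variable {E Q}

/-- `dL(q₀, q₁)(δq₀, δq₁)` for a function `L` on `Q × Q`. -/
def dLagrangian (L : Q × Q → ℝ) (q₀ q₁ : Q) (δ₀ : TangentSpace 𝓘(ℝ, E) q₀)
    (δ₁ : TangentSpace 𝓘(ℝ, E) q₁) : ℝ :=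
  (mfderiv (𝓘(ℝ, E).prod 𝓘(ℝ, E)) 𝓘(ℝ, ℝ) L (q₀, q₁) : E × E →L[ℝ] ℝ) (δ₀, δ₁)

/-- `dS_d(q_·)(δq_·) = ∑_{k=0}^{N-1} dL_d(q_k, q_{k+1})(δq_k, δq_{k+1})`, the differential of the
discrete action `S_d(q_·) = ∑_{k=0}^{N-1} L_d(q_k, q_{k+1})` of discrete curves
`q_· : {0, …, N} → Q`. -/
def dAction {N : ℕ} (L : Q × Q → ℝ) (q : Fin (N + 1) → Q)
    (δ : ∀ k, TangentSpace 𝓘(ℝ, E) (q k)) : ℝ :=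
  ∑ k : Fin N, dLagrangian L (q k.castSucc) (q k.succ) (δ k.castSucc) (δ k.succ)

/-- Variations of `q_·` with vanishing end points and values in `𝒟`. -/
def IsAdmissibleVariation {N : ℕ} (D : ∀ q : Q, Submodule ℝ (TangentSpace 𝓘(ℝ, E) q))
    (q : Fin (N + 1) → Q) (δ : ∀ k, TangentSpace 𝓘(ℝ, E) (q k)) : Prop :=
  δ 0 = 0 ∧ δ (Fin.last N) = 0 ∧ ∀ k, δ k ∈ D (q k)

/-- Trajectories of a nonholonomic discrete mechanical system `(Q, L_d, 𝒟, 𝒟_d)` (discrete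
Lagrange--D'Alembert principle). -/
def IsTrajectory {N : ℕ} (L : Q × Q → ℝ) (D : ∀ q : Q, Submodule ℝ (TangentSpace 𝓘(ℝ, E) q))
    (Dd : Set (Q × Q)) (q : Fin (N + 1) → Q) : Prop :=
  (∀ k : Fin N, (q k.castSucc, q k.succ) ∈ Dd) ∧
    ∀ δ : ∀ k, TangentSpace 𝓘(ℝ, E) (q k), IsAdmissibleVariation D q δ → dAction L q δ = 0

/-- Trajectories of a forced discrete mechanical system `(Q, L_d, 𝒟, 𝒟_d, f_d)`, where
`f q₀ q₁ δq₀ δq₁` is the value of the discrete force `f_d(q₀, q₁)` at `(δq₀, δq₁)`. -/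
def IsForcedTrajectory {N : ℕ} (L : Q × Q → ℝ)
    (D : ∀ q : Q, Submodule ℝ (TangentSpace 𝓘(ℝ, E) q)) (Dd : Set (Q × Q))
    (f : ∀ q₀ q₁ : Q, TangentSpace 𝓘(ℝ, E) q₀ → TangentSpace 𝓘(ℝ, E) q₁ → ℝ)
    (q : Fin (N + 1) → Q) : Prop :=
  (∀ k : Fin N, (q k.castSucc, q k.succ) ∈ Dd) ∧
    ∀ δ : ∀ k, TangentSpace 𝓘(ℝ, E) (q k), IsAdmissibleVariation D q δ →
      dAction L q δ +
        ∑ k : Fin N, f (q k.castSucc) (q k.succ) (δ k.castSucc) (δ k.succ) = 0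

end Systems

/-! ### Discrete horizontal lift and discrete connection form of a horizontal space -/

section SetLevel

variable {Q : Type*} (G : Type*) [Group G] [MulAction G Q]

/-- The orbit space `Q/G` (with the quotient topology). -/
abbrev OrbitSpace (Q : Type*) [MulAction G Q] : Type _ := MulAction.orbitRel.Quotient G Q

/-- The projection `π : Q → Q/G`. -/
def proj (q : Q) : OrbitSpace G Q := Quotient.mk _ q

/-- The domain of the discrete connection form of `Hor`: the pairs `(q₀, q₁)` for which there is
`g ∈ G` such that `(q₀, g⁻¹ q₁) ∈ Hor`. -/
def formDomain (Hor : Set (Q × Q)) : Set (Q × Q) :=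
  {p | ∃ g : G, (p.1, g⁻¹ • p.2) ∈ Hor}

variable {G}

open Classical in
/-- The discrete connection form of `Hor`: `𝒜_d(q₀, q₁) = g` if `(q₀, g⁻¹ q₁) ∈ Hor`
(with the value `1` outside its domain). -/
def connForm (Hor : Set (Q × Q)) (q₀ q₁ : Q) : G :=
  if h : ∃ g : G, (q₀, g⁻¹ • q₁) ∈ Hor then h.choose else 1

open Classical in
/-- The second component `h_{q₀}(r₁)` of the discrete horizontal lift: the point `q₁` over `r₁`
with `(q₀, q₁) ∈ Hor` (with the value `q₀` if there is no such point). -/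
def discreteLift (Hor : Set (Q × Q)) (q₀ : Q) (r₁ : OrbitSpace G Q) : Q :=
  if h : ∃ q₁ : Q, (q₀, q₁) ∈ Hor ∧ proj G q₁ = r₁ then h.choose else q₀

/-- The discrete curve `q_0 = q̄₀`, `q_{k+1} = h_{q_k}(r_{k+1})`. -/
def liftedCurve {N : ℕ} (Hor : Set (Q × Q)) (q₀ : Q) (r : Fin (N + 1) → OrbitSpace G Q) :
    Fin (N + 1) → Q :=
  fun k => Fin.induction (motive := fun _ => Q) q₀
    (fun j qj => discreteLift Hor qj (r j.succ)) k

variable (G Q)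

/-- The equivalence relation on `Q × G` of the action `g · (q, w) = (g q, g w g⁻¹)`. -/
def conjSetoid : Setoid (Q × G) where
  r a b := ∃ g : G, b = (g • a.1, g * a.2 * g⁻¹)
  iseqv :=
    { refl := fun a => ⟨1, by simp⟩
      symm := by
        rintro a _ ⟨g, rfl⟩
        exact ⟨g⁻¹, by simp [mul_assoc]⟩
      trans := by
        rintro a _ _ ⟨g, rfl⟩ ⟨k, rfl⟩
        exact ⟨k * g, by simp [mul_smul, mul_assoc]⟩ }

/-- The conjugate associated bundle `G̃ = (Q × G)/G`. -/
abbrev ConjBundle : Type _ := Quotient (conjSetoid Q G)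

variable {G Q}

/-- The quotient map `ρ : Q × G → G̃`. -/
def rho (q : Q) (w : G) : ConjBundle Q G := Quotient.mk _ (q, w)

/-- The projection `G̃ → Q/G`. -/
def ConjBundle.base (v : ConjBundle Q G) : OrbitSpace G Q :=
  Quotient.lift (fun a : Q × G => proj G a.1)
    (by
      rintro a _ ⟨g, rfl⟩
      exact (MulAction.orbitRel.Quotient.quotient_smul_eq (g := g) (a := a.1)).symm) v

/-- The inclusion `𝒴 : (Q/G) × (Q/G) → G̃ × (Q/G)`, `𝒴(r₀, r₁) = (ρ(q₀, e), r₁)` for `q₀` over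
`r₀`. -/
def inclusionY (p : OrbitSpace G Q × OrbitSpace G Q) : ConjBundle Q G × OrbitSpace G Q :=
  (rho p.1.out 1, p.2)

/-- `Ľ_d(q₀, w₀, r₁) = L_d(q₀, w₀ h_{q₀}(r₁))`. -/
def checkL (L : Q × Q → ℝ) (Hor : Set (Q × Q)) (q₀ : Q) (w₀ : G) (r₁ : OrbitSpace G Q) : ℝ :=
  L (q₀, w₀ • discreteLift Hor q₀ r₁)

/-- `L̂_d : G̃ × (Q/G) → ℝ`, `L̂_d(ρ(q₀, w₀), r₁) = Ľ_d(q₀, w₀, r₁)`. -/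
def hatL (L : Q × Q → ℝ) (Hor : Set (Q × Q)) (p : ConjBundle Q G × OrbitSpace G Q) : ℝ :=
  checkL L Hor p.1.out.1 p.1.out.2 p.2

/-- The reduced lagrangian `L̆_d = L̂_d ∘ 𝒴` on `(Q/G) × (Q/G)`. -/
def breveL (L : Q × Q → ℝ) (Hor : Set (Q × Q)) (p : OrbitSpace G Q × OrbitSpace G Q) : ℝ :=
  hatL L Hor (inclusionY p)

/-- The image `𝒟̂_d` of `𝒟_d` under
`Υ : Q × Q → G̃ × (Q/G)`, `Υ(q₀, q₁) = (ρ(q₀, 𝒜_d(q₀, q₁)), π(q₁))`. -/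
def hatDd (Dd : Set (Q × Q)) : Set (ConjBundle Q G × OrbitSpace G Q) :=
  (fun p : Q × Q => (rho p.1 (connForm Dd p.1 p.2), proj G p.2)) '' Dd

/-- The reduced kinematic constraints `𝒟̆_d = 𝒴⁻¹(𝒟̂_d)`. When the discrete connection form is
defined everywhere this is all of `(Q/G) × (Q/G)`; in general it is the set of the `(r₀, r₁)` such
that `h_{q₀}(r₁)` exists for `q₀` over `r₀`. -/
def breveDd (Dd : Set (Q × Q)) : Set (OrbitSpace G Q × OrbitSpace G Q) :=
  inclusionY ⁻¹' hatDd Dd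

end SetLevel

/-! ### Symmetries, connections and the reduced system -/

section Symmetry

variable {E EG EB Q G : Type*}
  [NormedAddCommGroup E] [NormedSpace ℝ E]
  [NormedAddCommGroup EG] [NormedSpace ℝ EG]
  [NormedAddCommGroup EB] [NormedSpace ℝ EB]
  [TopologicalSpace Q] [ChartedSpace E Q]
  [TopologicalSpace G] [ChartedSpace EG G] [Group G]
  [MulAction G Q]

variable (E EG EB Q G) in
/-- `π : Q → Q/G` is a smooth principal `G`-bundle: it is locally isomorphic, by equivariant
diffeomorphisms, to the trivial bundles `V × G → V`, `V ⊆ Q/G` open. In particular the action is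
free, and the smooth structure of `Q/G` is the only one for which `π` is a submersion. -/
def IsPrincipalBundle [ChartedSpace EB (OrbitSpace G Q)] : Prop :=
  ∀ r : OrbitSpace G Q, ∃ (V : Set (OrbitSpace G Q))
    (e : OpenPartialHomeomorph Q (OrbitSpace G Q × G)),
    r ∈ V ∧ IsOpen V ∧ e.source = proj G ⁻¹' V ∧ e.target = V ×ˢ Set.univ ∧
    ContMDiffOn 𝓘(ℝ, E) (𝓘(ℝ, EB).prod 𝓘(ℝ, EG)) ∞ e e.source ∧
    ContMDiffOn (𝓘(ℝ, EB).prod 𝓘(ℝ, EG)) 𝓘(ℝ, E) ∞ e.symm e.target ∧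
    ∀ q ∈ e.source, (e q).1 = proj G q ∧ ∀ g : G, (e (g • q)).2 = g * (e q).2

variable (E EG G) in
/-- The vertical space `𝒱^G_q = T_q(G q)`. -/
def verticalSpace (q : Q) : Submodule ℝ (TangentSpace 𝓘(ℝ, E) q) :=
  LinearMap.range (ContinuousLinearMap.toLinearMap (M := EG) (M₂ := E)
    (mfderiv 𝓘(ℝ, EG) 𝓘(ℝ, E) (fun g : G => g • q) 1))

variable (G) in
/-- `G` is a symmetry group of `(Q, L_d, 𝒟, 𝒟_d)`: `L_d` and `𝒟_d` are invariant under the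
diagonal action and `𝒟` is invariant under the lifted action. -/
structure IsSymmetryGroup [IsManifold 𝓘(ℝ, E) ∞ Q] (S : DiscreteMechanicalSystem E Q) : Prop where
  L_invariant : ∀ (g : G) (q₀ q₁ : Q), S.L (g • q₀, g • q₁) = S.L (q₀, q₁)
  Dd_invariant : ∀ (g : G) (q₀ q₁ : Q), (q₀, q₁) ∈ S.Dd → (g • q₀, g • q₁) ∈ S.Dd
  D_invariant : ∀ (g : G) (q : Q), ∀ v ∈ S.D q,
    mfderiv 𝓘(ℝ, E) 𝓘(ℝ, E) (fun x : Q => g • x) q v ∈ S.D (g • q)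

variable (E EG G) in
/-- `Hor ⊆ Q × Q` defines an affine discrete connection on `π : Q → Q/G`, with a well defined
smooth discrete connection form on the open set `formDomain G Hor` (which may be all of `Q × Q`).
Here `{q₁ | (q, q₁) ∈ Hor}` is `Hor²(q)`. -/
structure IsAffineDiscreteConnection (Hor : Set (Q × Q)) : Prop where
  submanifold : IsSubmanifold (𝓘(ℝ, E).prod 𝓘(ℝ, E)) Hor
  invariant : ∀ (g : G) (q₀ q₁ : Q), (q₀, q₁) ∈ Hor → (g • q₀, g • q₁) ∈ Hor
  /-- `Hor` contains the graph `Γ` of `q ↦ γ(q) q` for a level `γ` -/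
  exists_level : ∃ γ : Q → G, ContMDiff 𝓘(ℝ, E) 𝓘(ℝ, EG) ∞ γ ∧
    (∀ (g : G) (q : Q), γ (g • q) = g * γ q * g⁻¹) ∧ ∀ q : Q, (q, γ q • q) ∈ Hor
  submanifold_fiber : ∀ q : Q, IsSubmanifold 𝓘(ℝ, E) {q₁ | (q, q₁) ∈ Hor}
  transversal : ∀ q q₁ : Q, q₁ ∈ MulAction.orbit G q → (q, q₁) ∈ Hor →
    IsCompl (verticalSpace E EG G q₁) (submanifoldTangent 𝓘(ℝ, E) {q' | (q, q') ∈ Hor} q₁)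
  /-- there is at most one `g` with `(q₀, g⁻¹ q₁) ∈ Hor` -/
  unique : ∀ (q₀ q₁ : Q) (g g' : G), (q₀, g⁻¹ • q₁) ∈ Hor → (q₀, g'⁻¹ • q₁) ∈ Hor → g = g'
  isOpen_formDomain : IsOpen (formDomain G Hor)
  smooth_connForm : ContMDiffOn (𝓘(ℝ, E).prod 𝓘(ℝ, E)) 𝓘(ℝ, EG) ∞
    (fun p : Q × Q => (connForm Hor p.1 p.2 : G)) (formDomain G Hor)

variable (EG G) in
/-- Chaplygin type symmetry groups: `TQ = 𝒱^G ⊕ 𝒟` and `𝒟_d` defines an affine discrete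
connection. -/
structure IsChaplyginSymmetryGroup [IsManifold 𝓘(ℝ, E) ∞ Q] (S : DiscreteMechanicalSystem E Q) :
    Prop where
  symmetry : IsSymmetryGroup G S
  isCompl : ∀ q : Q, IsCompl (verticalSpace E EG G q) (S.D q)
  discreteConnection : IsAffineDiscreteConnection E EG G S.Dd

variable [ChartedSpace EB (OrbitSpace G Q)]

/-- `dπ(q) : T_q Q → T_{π(q)}(Q/G)`. -/
def dproj (q : Q) :
    TangentSpace 𝓘(ℝ, E) q →L[ℝ] TangentSpace 𝓘(ℝ, EB) (proj G q) :=
  mfderiv 𝓘(ℝ, E) 𝓘(ℝ, EB) (proj G) q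

open Classical in
/-- The horizontal lift at `q` of the connection with horizontal space `D`: the vector
`v ∈ D_q` with `dπ(q)(v) = w` (with the value `0` if there is none). -/
def horizontalLift (D : ∀ q : Q, Submodule ℝ (TangentSpace 𝓘(ℝ, E) q)) (q : Q)
    (w : TangentSpace 𝓘(ℝ, EB) (proj G q)) : TangentSpace 𝓘(ℝ, E) q :=
  if h : ∃ v ∈ D q, dproj (EB := EB) (G := G) q v = w then h.choose else 0

/-- The reduced variational constraints `𝒟̆_r = dπ(q)(𝒟_q)` for `q` over `r`. -/
def breveD (D : ∀ q : Q, Submodule ℝ (TangentSpace 𝓘(ℝ, E) q)) (r : OrbitSpace G Q) :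
    Submodule ℝ (TangentSpace 𝓘(ℝ, EB) r) :=
  Submodule.map (ContinuousLinearMap.toLinearMap (M := E) (M₂ := EB)
    (dproj (EB := EB) (G := G) r.out)) (D r.out)

variable (EG) in
/-- `D₂Ľ_d(q₀, w₀, r₁) (d𝒜_d(q₀, q₁)(h^{q₀}(δr₀), h^{q₁}(δr₁)))` with `q₁ = w₀ h_{q₀}(r₁)`, where
`h^q` is the horizontal lift of the connection with horizontal space `D`. -/
def checkF (L : Q × Q → ℝ) (D : ∀ q : Q, Submodule ℝ (TangentSpace 𝓘(ℝ, E) q))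
    (Hor : Set (Q × Q)) (q₀ : Q) (w₀ : G) (r₁ : OrbitSpace G Q) (δ₀ δ₁ : EB) : ℝ :=
  let q₁ : Q := w₀ • discreteLift Hor q₀ r₁
  (mfderiv 𝓘(ℝ, EG) 𝓘(ℝ, ℝ) (fun w : G => checkL L Hor q₀ w r₁) w₀ : EG →L[ℝ] ℝ)
    ((mfderiv (𝓘(ℝ, E).prod 𝓘(ℝ, E)) 𝓘(ℝ, EG)
        (fun p : Q × Q => (connForm Hor p.1 p.2 : G)) (q₀, q₁) : E × E →L[ℝ] EG)
      (horizontalLift (EB := EB) (G := G) D q₀ δ₀, horizontalLift (EB := EB) (G := G) D q₁ δ₁))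

variable (EG) in
/-- The reduced discrete force `F̂_d(v₀, r₁)(δr₀, δr₁)`, computed from `(q₀, w₀)` with
`v₀ = ρ(q₀, w₀)`. -/
def hatF (L : Q × Q → ℝ) (D : ∀ q : Q, Submodule ℝ (TangentSpace 𝓘(ℝ, E) q))
    (Hor : Set (Q × Q)) (v : ConjBundle Q G) (r₁ : OrbitSpace G Q)
    (δ₀ : TangentSpace 𝓘(ℝ, EB) v.base) (δ₁ : TangentSpace 𝓘(ℝ, EB) r₁) : ℝ :=
  checkF (EB := EB) EG L D Hor v.out.1 v.out.2 r₁ δ₀ δ₁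

variable (EG) in
/-- The discrete force `F̆_d = 𝒴^* F̂_d` on `(Q/G) × (Q/G)`. -/
def breveF (L : Q × Q → ℝ) (D : ∀ q : Q, Submodule ℝ (TangentSpace 𝓘(ℝ, E) q))
    (Hor : Set (Q × Q)) (r₀ r₁ : OrbitSpace G Q)
    (δ₀ : TangentSpace 𝓘(ℝ, EB) r₀) (δ₁ : TangentSpace 𝓘(ℝ, EB) r₁) : ℝ :=
  hatF EG L D Hor (inclusionY (r₀, r₁)).1 (inclusionY (r₀, r₁)).2 δ₀ δ₁

end Symmetry

end DiscreteReduction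

end

/-! The theorem rests on one identity: if $(q_0,q_1)\in\mathcal D_d$ and $\delta q_0,\delta q_1$ lie
in $\mathcal D$, then $dL_d(\delta q_0,\delta q_1)=(d\breve L_d+\breve F_d)(d\pi\,\delta
q_0,d\pi\,\delta q_1)$ (`dLagrangian_eq_breve`). Summed along the lifted curve, it turns
$dS_d(\delta q_\cdot)$ into the forced expression for $d\pi(\delta q_\cdot)$. That variation is
admissible on $Q/G$, so the sum vanishes.

For the identity, split a pair $p=(q_0,q_1)$ into its group part $\mathcal A_d(p)$ and its
horizontal part $P(p)=(q_0,\mathcal A_d(p)^{-1}q_1)$, so that $L_d=C(\mathcal A_d,P)$ with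
$C(w,(a,b))=L_d(a,wb)$. On $\mathcal D_d$ one has $\mathcal A_d=e$ and $P(p)=p$, so the derivative
there is $d(L_d\circ P)$ plus the vertical derivative of $L_d$ along $d\mathcal A_d$
(`dLagrangian_eq`). Invariance gives $L_d\circ P=\breve L_d\circ(\pi\times\pi)$ on an open set
(`breveL_proj`), so the first term is $d\breve L_d$. Vectors of $\mathcal D$ are the horizontal
lifts of their projections (`horizontalLift_eq`), so the second term is $\breve F_d$. -/

namespace DiscreteReduction

/-! ### Orbits, discrete horizontal lifts and choices of representatives -/

section SetLevel

variable {Q G : Type*} [Group G] [MulAction G Q]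

theorem proj_eq_proj_iff {q q' : Q} : proj G q = proj G q' ↔ ∃ g : G, q' = g • q := by
  constructor
  · intro h
    obtain ⟨g, hg⟩ := MulAction.orbitRel_apply.1 (Quotient.exact h.symm)
    exact ⟨g, hg.symm⟩
  · rintro ⟨g, rfl⟩
    exact (MulAction.orbitRel.Quotient.quotient_smul_eq (g := g) (a := q)).symm

@[simp]
theorem proj_smul (g : G) (q : Q) : proj G (g • q) = proj G q :=
  (proj_eq_proj_iff.2 ⟨g, rfl⟩).symm

theorem proj_out (r : OrbitSpace G Q) : proj G (Quotient.out r) = r :=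
  Quotient.out_eq r

variable {Hor : Set (Q × Q)}

/-- Two candidates over the same orbit differ by some $g$, and uniqueness of the discrete connection
form, applied to $e$ and $g^{-1}$, forces $g=e$. This makes the chosen lift computable. -/
theorem discreteLift_eq
    (hun : ∀ (q₀ q₁ : Q) (g g' : G), (q₀, g⁻¹ • q₁) ∈ Hor → (q₀, g'⁻¹ • q₁) ∈ Hor → g = g')
    {q₀ q₁ : Q} (h : (q₀, q₁) ∈ Hor) : discreteLift Hor q₀ (proj G q₁) = q₁ := by
  have hex : ∃ q' : Q, (q₀, q') ∈ Hor ∧ proj G q' = proj G q₁ := ⟨q₁, h, rfl⟩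
  rw [discreteLift, dif_pos hex]
  obtain ⟨h₁, h₂⟩ := hex.choose_spec
  obtain ⟨g, hg⟩ := proj_eq_proj_iff.1 h₂.symm
  rw [hg] at h₁ ⊢
  have := hun q₀ q₁ 1 g⁻¹ (by simpa using h) (by simpa using h₁)
  rw [inv_eq_one.1 this.symm, one_smul]

theorem connForm_mem {q₀ q₁ : Q} (h : (q₀, q₁) ∈ formDomain G Hor) :
    (q₀, (connForm Hor q₀ q₁ : G)⁻¹ • q₁) ∈ Hor := by
  have h' : ∃ g : G, (q₀, g⁻¹ • q₁) ∈ Hor := h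
  rw [connForm, dif_pos h']
  exact h'.choose_spec

theorem mem_formDomain {q₀ q₁ : Q} (h : (q₀, q₁) ∈ Hor) : (q₀, q₁) ∈ formDomain G Hor :=
  ⟨1, by simpa using h⟩

theorem connForm_eq_one
    (hun : ∀ (q₀ q₁ : Q) (g g' : G), (q₀, g⁻¹ • q₁) ∈ Hor → (q₀, g'⁻¹ • q₁) ∈ Hor → g = g')
    {q₀ q₁ : Q} (h : (q₀, q₁) ∈ Hor) : (connForm Hor q₀ q₁ : G) = 1 :=
  hun q₀ q₁ _ _ (connForm_mem (mem_formDomain h)) (by simpa using h)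

/-- Conjugation fixes $e$, so every representative of $\rho(q,e)$ has group component $e$ and base
point in $Gq$. The reduced objects, which are built from an arbitrary representative, can therefore
be evaluated at $(gq,e)$ for some unknown $g$; invariance then removes $g$. -/
theorem exists_out_rho_one (q : Q) :
    ∃ g : G, (rho (Quotient.out (proj G q)) (1 : G)).out = (g • q, 1) := by
  obtain ⟨g, hg⟩ := Quotient.exact (Quotient.out_eq (rho (Quotient.out (proj G q)) (1 : G))).symm
  obtain ⟨k, hk⟩ := proj_eq_proj_iff.1 (proj_out (proj G q)).symm
  refine ⟨g * k, ?_⟩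
  rw [hg]
  simp only [mul_one, mul_inv_cancel, mul_smul]
  rw [← hk]

theorem breveL_eq (hinv : ∀ (g : G) (q₀ q₁ : Q), (q₀, q₁) ∈ Hor → (g • q₀, g • q₁) ∈ Hor)
    (hun : ∀ (q₀ q₁ : Q) (g g' : G), (q₀, g⁻¹ • q₁) ∈ Hor → (q₀, g'⁻¹ • q₁) ∈ Hor → g = g')
    {L : Q × Q → ℝ} (hL : ∀ (g : G) (q₀ q₁ : Q), L (g • q₀, g • q₁) = L (q₀, q₁))
    {q₀ q₁ : Q} (h : (q₀, q₁) ∈ Hor) :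
    breveL L Hor (proj G q₀, proj G q₁) = L (q₀, q₁) := by
  obtain ⟨g, hg⟩ := exists_out_rho_one (G := G) q₀
  simp only [breveL, hatL, inclusionY, checkL]
  rw [hg]
  dsimp only
  rw [one_smul, ← proj_smul g q₁, discreteLift_eq hun (hinv g _ _ h), hL]

/-- Membership supplies a pair of `Hor` over $(\pi(q_0),r_1)$, and translating it by the group makes
it start at $q_0$. Hence the recursion for the lifted curve never falls back on the default value of
`discreteLift`. -/
theorem exists_mem_of_mem_breveDd
    (hinv : ∀ (g : G) (q₀ q₁ : Q), (q₀, q₁) ∈ Hor → (g • q₀, g • q₁) ∈ Hor)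
    {q₀ : Q} {r₁ : OrbitSpace G Q} (h : (proj G q₀, r₁) ∈ breveDd Hor) :
    ∃ q₁, (q₀, q₁) ∈ Hor ∧ proj G q₁ = r₁ := by
  obtain ⟨⟨a, b⟩, hab, he⟩ := h
  obtain ⟨he₁, he₂⟩ := Prod.ext_iff.1 he
  have hb := congrArg ConjBundle.base he₁
  have ha : proj G a = proj G q₀ := hb.trans (proj_out _)
  obtain ⟨g, rfl⟩ := proj_eq_proj_iff.1 ha
  exact ⟨g • b, hinv g _ _ hab, (proj_smul g b).trans he₂⟩

theorem liftedCurve_succ {N : ℕ} (q₀ : Q) (r : Fin (N + 1) → OrbitSpace G Q) (k : Fin N) :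
    liftedCurve Hor q₀ r k.succ = discreteLift Hor (liftedCurve Hor q₀ r k.castSucc) (r k.succ) :=
  rfl

theorem proj_liftedCurve
    (hinv : ∀ (g : G) (q₀ q₁ : Q), (q₀, q₁) ∈ Hor → (g • q₀, g • q₁) ∈ Hor)
    (hun : ∀ (q₀ q₁ : Q) (g g' : G), (q₀, g⁻¹ • q₁) ∈ Hor → (q₀, g'⁻¹ • q₁) ∈ Hor → g = g')
    {N : ℕ} {q₀ : Q} {r : Fin (N + 1) → OrbitSpace G Q} (h₀ : proj G q₀ = r 0)
    (hr : ∀ k : Fin N, (r k.castSucc, r k.succ) ∈ breveDd Hor) (k : Fin (N + 1)) :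
    proj G (liftedCurve Hor q₀ r k) = r k := by
  induction k using Fin.induction with
  | zero => exact h₀
  | succ k ih =>
    obtain ⟨q₁, h₁, h₂⟩ := exists_mem_of_mem_breveDd hinv (ih ▸ hr k)
    rw [liftedCurve_succ, ← h₂, discreteLift_eq hun h₁]

theorem liftedCurve_mem
    (hinv : ∀ (g : G) (q₀ q₁ : Q), (q₀, q₁) ∈ Hor → (g • q₀, g • q₁) ∈ Hor)
    (hun : ∀ (q₀ q₁ : Q) (g g' : G), (q₀, g⁻¹ • q₁) ∈ Hor → (q₀, g'⁻¹ • q₁) ∈ Hor → g = g')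
    {N : ℕ} {q₀ : Q} {r : Fin (N + 1) → OrbitSpace G Q} (h₀ : proj G q₀ = r 0)
    (hr : ∀ k : Fin N, (r k.castSucc, r k.succ) ∈ breveDd Hor) (k : Fin N) :
    (liftedCurve Hor q₀ r k.castSucc, liftedCurve Hor q₀ r k.succ) ∈ Hor := by
  obtain ⟨q₁, h₁, h₂⟩ := exists_mem_of_mem_breveDd hinv
    (proj_liftedCurve hinv hun h₀ hr k.castSucc ▸ hr k)
  rw [liftedCurve_succ, ← h₂, discreteLift_eq hun h₁]
  exact h₁

end SetLevel

/-! ### The differential of the bundle projection and horizontal lifts -/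

section Smooth

variable {E EG EB Q G : Type*}
  [NormedAddCommGroup E] [NormedSpace ℝ E]
  [NormedAddCommGroup EG] [NormedSpace ℝ EG]
  [NormedAddCommGroup EB] [NormedSpace ℝ EB]
  [TopologicalSpace Q] [ChartedSpace E Q]
  [TopologicalSpace G] [ChartedSpace EG G] [Group G]
  [MulAction G Q] [ChartedSpace EB (OrbitSpace G Q)]

theorem IsPrincipalBundle.mdifferentiableAt_proj (hπ : IsPrincipalBundle E EG EB Q G) (q : Q) :
    MDifferentiableAt 𝓘(ℝ, E) 𝓘(ℝ, EB) (proj G) q := by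
  obtain ⟨V, e, hV, -, hs, -, he, -, hq⟩ := hπ (proj G q)
  have hmem : q ∈ e.source := hs ▸ hV
  have h1 : MDifferentiableAt 𝓘(ℝ, E) (𝓘(ℝ, EB).prod 𝓘(ℝ, EG)) e q :=
    (he.contMDiffAt (e.open_source.mem_nhds hmem)).mdifferentiableAt (by simp)
  refine (mdifferentiableAt_fst.comp q h1).congr_of_eventuallyEq ?_
  filter_upwards [e.open_source.mem_nhds hmem] with x hx using (hq x hx).1.symm

/-- A smooth local section of `π` through a given point. -/
theorem IsPrincipalBundle.exists_section (hπ : IsPrincipalBundle E EG EB Q G) (q : Q) :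
    ∃ s : OrbitSpace G Q → Q, MDifferentiableAt 𝓘(ℝ, EB) 𝓘(ℝ, E) s (proj G q) ∧
      s (proj G q) = q ∧ ∀ᶠ r in 𝓝 (proj G q), proj G (s r) = r := by
  obtain ⟨V, e, hV, hVo, hs, ht, -, he, hq⟩ := hπ (proj G q)
  have hmem : q ∈ e.source := hs ▸ hV
  have heq : (proj G q, (e q).2) = e q := Prod.ext (hq q hmem).1.symm rfl
  have htm : ∀ r ∈ V, (r, (e q).2) ∈ e.target := fun r hr => ht ▸ ⟨hr, Set.mem_univ _⟩
  refine ⟨fun r => e.symm (r, (e q).2), ?_, ?_, ?_⟩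
  · have h1 : MDifferentiableAt (𝓘(ℝ, EB).prod 𝓘(ℝ, EG)) 𝓘(ℝ, E) e.symm
        (proj G q, (e q).2) :=
      (he.contMDiffAt (e.open_target.mem_nhds (htm _ hV))).mdifferentiableAt (by simp)
    exact h1.comp (proj G q) (mdifferentiableAt_id.prodMk mdifferentiableAt_const)
  · dsimp only
    rw [heq, e.left_inv hmem]
  · filter_upwards [hVo.mem_nhds hV] with r hr
    rw [← (hq _ (e.map_target (htm r hr))).1, e.right_inv (htm r hr)]

variable (EG) in
theorem mdifferentiableAt_const_smul [ContMDiffSMul 𝓘(ℝ, EG) 𝓘(ℝ, E) ∞ G Q] (g : G) (q : Q) :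
    MDifferentiableAt 𝓘(ℝ, E) 𝓘(ℝ, E) (fun x : Q => g • x) q :=
  (ContMDiffSMul.contMDiff_const_smul (I := 𝓘(ℝ, EG)) (I' := 𝓘(ℝ, E)) (n := ∞) g
    q).mdifferentiableAt (by simp)

variable [ContMDiffSMul 𝓘(ℝ, EG) 𝓘(ℝ, E) ∞ G Q]

theorem mdifferentiableAt_smul_const (g : G) (q : Q) :
    MDifferentiableAt 𝓘(ℝ, EG) 𝓘(ℝ, E) (fun x : G => x • q) g :=
  ((contMDiff_id.smul contMDiff_const : ContMDiff 𝓘(ℝ, EG) 𝓘(ℝ, E) ∞ (fun x : G => x • q))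
    g).mdifferentiableAt (by simp)

theorem IsPrincipalBundle.mfderiv_proj_smul (hπ : IsPrincipalBundle E EG EB Q G) (g : G) (q : Q)
    (v : E) :
    (mfderiv 𝓘(ℝ, E) 𝓘(ℝ, EB) (proj G) (g • q) : E →L[ℝ] EB)
      ((mfderiv 𝓘(ℝ, E) 𝓘(ℝ, E) (fun x : Q => g • x) q : E →L[ℝ] E) v) =
    (mfderiv 𝓘(ℝ, E) 𝓘(ℝ, EB) (proj G) q : E →L[ℝ] EB) v := by
  have h := mfderiv_comp_apply q (hπ.mdifferentiableAt_proj (g • q))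
    (mdifferentiableAt_const_smul EG g q) v
  have h' : (proj G ∘ fun x : Q => g • x) = proj G := funext fun x => proj_smul g x
  rw [h'] at h
  exact h.symm

variable [LieGroup 𝓘(ℝ, EG) ∞ G]

/-- In an equivariant trivialization, a vector killed by $d\pi$ becomes $(0,\xi)$, and the fibre of
the trivialization is the orbit. So the vector is tangent to the orbit. -/
theorem IsPrincipalBundle.ker_dproj_le (hπ : IsPrincipalBundle E EG EB Q G) (q : Q) (v : E)
    (hv : (mfderiv 𝓘(ℝ, E) 𝓘(ℝ, EB) (proj G) q : E →L[ℝ] EB) v = 0) :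
    v ∈ verticalSpace E EG G q := by
  obtain ⟨V, e, hV, hVo, hs, ht, he, he', hq⟩ := hπ (proj G q)
  have hmem : q ∈ e.source := hs ▸ hV
  have hmemt : e q ∈ e.target := e.map_source hmem
  have h1 : MDifferentiableAt 𝓘(ℝ, E) (𝓘(ℝ, EB).prod 𝓘(ℝ, EG)) e q :=
    (he.contMDiffAt (e.open_source.mem_nhds hmem)).mdifferentiableAt (by simp)
  have h2 : MDifferentiableAt (𝓘(ℝ, EB).prod 𝓘(ℝ, EG)) 𝓘(ℝ, E) e.symm (e q) :=
    (he'.contMDiffAt (e.open_target.mem_nhds hmemt)).mdifferentiableAt (by simp)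
  have hid : mfderiv 𝓘(ℝ, E) 𝓘(ℝ, E) (e.symm ∘ e) q v = v := by
    have : (e.symm ∘ e) =ᶠ[𝓝 q] id := by
      filter_upwards [e.open_source.mem_nhds hmem] with x hx using e.left_inv hx
    rw [this.mfderiv_eq, mfderiv_id]
    rfl
  have hfst : ((mfderiv 𝓘(ℝ, E) (𝓘(ℝ, EB).prod 𝓘(ℝ, EG)) e q : E →L[ℝ] EB × EG) v).1 = 0 := by
    have : (Prod.fst ∘ e) =ᶠ[𝓝 q] proj G := by
      filter_upwards [e.open_source.mem_nhds hmem] with x hx using (hq x hx).1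
    have h3 := mfderiv_comp_apply q (mdifferentiableAt_fst (x := e q)) h1 v
    rw [this.mfderiv_eq, mfderiv_fst] at h3
    exact h3.symm.trans hv
  set ξ : EG := ((mfderiv 𝓘(ℝ, E) (𝓘(ℝ, EB).prod 𝓘(ℝ, EG)) e q : E →L[ℝ] EB × EG) v).2 with hξ
  set g₀ : G := (e q).2 with hg₀
  -- By equivariance, the fibre through $q$ is the orbit map precomposed with right translation
  -- taking $g_0$ to $e$.
  have hsymm : (fun h : G => e.symm ((e q).1, h)) = (fun k : G => k • q) ∘ fun h => h * g₀⁻¹ := by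
    funext h
    have hm : (h * g₀⁻¹) • q ∈ e.source := by
      rw [hs, Set.mem_preimage, proj_smul]; exact hV
    have : e ((h * g₀⁻¹) • q) = ((e q).1, h) := by
      refine Prod.ext ?_ ?_
      · rw [(hq _ hm).1, (hq _ hmem).1, proj_smul]
      · rw [(hq _ hmem).2, ← hg₀, inv_mul_cancel_right]
    rw [← this, e.left_inv hm]
    rfl
  have hmul : MDifferentiableAt 𝓘(ℝ, EG) 𝓘(ℝ, EG) (fun h : G => h * g₀⁻¹) g₀ :=
    ((contMDiff_id.mul contMDiff_const :
      ContMDiff 𝓘(ℝ, EG) 𝓘(ℝ, EG) ∞ fun h : G => h * g₀⁻¹) g₀).mdifferentiableAt (by simp)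
  -- The Lie algebra element is $\xi$, tangent to $G$ at $g_0$, right-translated to the identity.
  refine ⟨(mfderiv 𝓘(ℝ, EG) 𝓘(ℝ, EG) (fun h : G => h * g₀⁻¹) g₀ : EG →L[ℝ] EG) ξ, ?_⟩
  have h4 := mfderiv_comp_apply_of_eq (I := 𝓘(ℝ, EG)) (I' := 𝓘(ℝ, EG)) (I'' := 𝓘(ℝ, E)) (x := g₀)
    (mdifferentiableAt_smul_const (E := E) (EG := EG) (1 : G) q) hmul (mul_inv_cancel g₀) ξ
  refine h4.symm.trans ?_
  rw [← hsymm]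
  have h5 := mfderiv_comp_apply q h2 h1 v
  rw [hid, mfderiv_prod_eq_add_apply h2] at h5
  refine Eq.trans ?_ h5.symm
  have h6 : (mfderiv 𝓘(ℝ, EB) 𝓘(ℝ, E) (fun z => e.symm (z, (e q).2)) (e q).1 : EB →L[ℝ] E)
      ((mfderiv 𝓘(ℝ, E) (𝓘(ℝ, EB).prod 𝓘(ℝ, EG)) e q : E →L[ℝ] EB × EG) v).1 = 0 := by
    rw [hfst]
    exact map_zero (mfderiv 𝓘(ℝ, EB) 𝓘(ℝ, E) (fun z => e.symm (z, (e q).2)) (e q).1 : EB →L[ℝ] E)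
  exact (zero_add _).symm.trans (congrArg (· + _) h6.symm)

/-- Two vectors of $\mathcal D_q$ with the same projection differ by an element of $\mathcal
V^G_q\cap\mathcal D_q=0$. -/
theorem IsPrincipalBundle.horizontalLift_eq (hπ : IsPrincipalBundle E EG EB Q G)
    {D : ∀ q : Q, Submodule ℝ (TangentSpace 𝓘(ℝ, E) q)} (q : Q)
    (hD : IsCompl (verticalSpace E EG G q) (D q)) {v : E} (hv : v ∈ D q) {w : EB}
    (hw : (mfderiv 𝓘(ℝ, E) 𝓘(ℝ, EB) (proj G) q : E →L[ℝ] EB) v = w) :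
    (horizontalLift (EB := EB) (G := G) D q w : E) = v := by
  have hex : ∃ v ∈ D q, dproj (EB := EB) (G := G) q v = w := ⟨v, hv, hw⟩
  have hlift : horizontalLift (EB := EB) (G := G) D q w = hex.choose := dif_pos hex
  rw [hlift]
  obtain ⟨h₁, h₂⟩ := hex.choose_spec
  set u : E := hex.choose
  have hsub : u - v ∈ D q := (D q).sub_mem h₁ hv
  have hker : u - v ∈ verticalSpace E EG G q := by
    refine hπ.ker_dproj_le q _ ?_
    have h₂' : (mfderiv 𝓘(ℝ, E) 𝓘(ℝ, EB) (proj G) q : E →L[ℝ] EB) u = w := h₂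
    exact (map_sub (mfderiv 𝓘(ℝ, E) 𝓘(ℝ, EB) (proj G) q : E →L[ℝ] EB) u v).trans
      (sub_eq_zero.2 (h₂'.trans hw.symm))
  exact sub_eq_zero.1 (Submodule.disjoint_def.1 hD.disjoint _ hker hsub)

end Smooth

/-! ### Comparison of $dL_d$ with the reduced lagrangian and force -/

section Reduction

variable {E EG EB Q G : Type*}
  [NormedAddCommGroup E] [NormedSpace ℝ E]
  [NormedAddCommGroup EG] [NormedSpace ℝ EG]
  [NormedAddCommGroup EB] [NormedSpace ℝ EB]
  [TopologicalSpace Q] [ChartedSpace E Q]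
  [TopologicalSpace G] [ChartedSpace EG G] [Group G]
  [MulAction G Q]

theorem dLagrangian_congr (L : Q × Q → ℝ) {q₀ q₁ q₀' q₁' : Q} (h₀ : q₀ = q₀') (h₁ : q₁ = q₁')
    {v₀ v₁ v₀' v₁' : E} (hv₀ : v₀ = v₀') (hv₁ : v₁ = v₁') :
    dLagrangian (E := E) L q₀ q₁ v₀ v₁ = dLagrangian (E := E) L q₀' q₁' v₀' v₁' := by
  subst h₀ h₁ hv₀ hv₁
  rfl

variable (EG) in
theorem dLagrangian_smul [ContMDiffSMul 𝓘(ℝ, EG) 𝓘(ℝ, E) ∞ G Q] {L : Q × Q → ℝ}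
    (hLs : ContMDiff (𝓘(ℝ, E).prod 𝓘(ℝ, E)) 𝓘(ℝ, ℝ) ∞ L)
    (hL : ∀ (g : G) (q₀ q₁ : Q), L (g • q₀, g • q₁) = L (q₀, q₁)) (g : G) (q₀ q₁ : Q) (v₀ v₁ : E) :
    dLagrangian (E := E) L (g • q₀) (g • q₁)
      ((mfderiv 𝓘(ℝ, E) 𝓘(ℝ, E) (fun x : Q => g • x) q₀ : E →L[ℝ] E) v₀)
      ((mfderiv 𝓘(ℝ, E) 𝓘(ℝ, E) (fun x : Q => g • x) q₁ : E →L[ℝ] E) v₁) =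
    dLagrangian (E := E) L q₀ q₁ v₀ v₁ := by
  have h₀ := mdifferentiableAt_const_smul (E := E) EG g q₀
  have h₁ := mdifferentiableAt_const_smul (E := E) EG g q₁
  have hP : MDifferentiableAt (𝓘(ℝ, E).prod 𝓘(ℝ, E)) (𝓘(ℝ, E).prod 𝓘(ℝ, E))
      (Prod.map (fun x : Q => g • x) (fun x : Q => g • x)) (q₀, q₁) := h₀.prodMap h₁
  have hLd : MDifferentiableAt (𝓘(ℝ, E).prod 𝓘(ℝ, E)) 𝓘(ℝ, ℝ) L (g • q₀, g • q₁) :=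
    (hLs _).mdifferentiableAt (by simp)
  have h := mfderiv_comp_apply (q₀, q₁) hLd hP (v₀, v₁)
  have hcomp : L ∘ Prod.map (fun x : Q => g • x) (fun x : Q => g • x) = L :=
    funext fun p => hL g p.1 p.2
  rw [hcomp, mfderiv_prodMap (p := (q₀, q₁)) h₀ h₁] at h
  exact h.symm

theorem mdifferentiableAt_connForm {Hor : Set (Q × Q)}
    (hA : IsAffineDiscreteConnection E EG G Hor) {q₀ q₁ : Q} (h : (q₀, q₁) ∈ Hor) :
    MDifferentiableAt (𝓘(ℝ, E).prod 𝓘(ℝ, E)) 𝓘(ℝ, EG)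
      (fun p : Q × Q => (connForm Hor p.1 p.2 : G)) (q₀, q₁) :=
  (hA.smooth_connForm.contMDiffAt
    (hA.isOpen_formDomain.mem_nhds (mem_formDomain h))).mdifferentiableAt (by simp)

/-- The projection `(q₀, q₁) ↦ (q₀, 𝒜_d(q₀, q₁)⁻¹ q₁)` to the horizontal space `Hor`. -/
noncomputable def horProj (G : Type*) [Group G] [MulAction G Q] (Hor : Set (Q × Q)) (p : Q × Q) : Q × Q :=
  (p.1, (connForm Hor p.1 p.2 : G)⁻¹ • p.2)

theorem horProj_eq {Hor : Set (Q × Q)}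
    (hA : IsAffineDiscreteConnection E EG G Hor) {q₀ q₁ : Q} (h : (q₀, q₁) ∈ Hor) :
    horProj G Hor (q₀, q₁) = (q₀, q₁) := by
  simp [horProj, connForm_eq_one hA.unique h]

/-- The equality holds on the whole open domain of the connection form, not just on `Hor`, so it can
be differentiated at points of `Hor`. -/
theorem breveL_proj {Hor : Set (Q × Q)} (hA : IsAffineDiscreteConnection E EG G Hor)
    {L : Q × Q → ℝ} (hL : ∀ (g : G) (q₀ q₁ : Q), L (g • q₀, g • q₁) = L (q₀, q₁))
    {p : Q × Q} (hp : p ∈ formDomain G Hor) :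
    breveL L Hor (proj G p.1, proj G p.2) = L (horProj G Hor p) := by
  rw [horProj, ← breveL_eq hA.invariant hA.unique hL (connForm_mem hp), proj_smul]

variable (EG G) in
/-- The derivative of `w ↦ L(q₀, w q₁)` at the identity. -/
noncomputable def verticalDeriv (L : Q × Q → ℝ) (q₀ q₁ : Q) : EG →L[ℝ] ℝ :=
  mfderiv 𝓘(ℝ, EG) 𝓘(ℝ, ℝ) (fun w : G => L (q₀, w • q₁)) 1

variable (E EG G) in
/-- The derivative of the discrete connection form. -/
noncomputable def dConnForm (Hor : Set (Q × Q)) (q₀ q₁ : Q) : E × E →L[ℝ] EG :=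
  mfderiv (𝓘(ℝ, E).prod 𝓘(ℝ, E)) 𝓘(ℝ, EG) (fun p : Q × Q => (connForm Hor p.1 p.2 : G)) (q₀, q₁)

variable [ChartedSpace EB (OrbitSpace G Q)]

theorem checkF_one (L : Q × Q → ℝ) (D : ∀ q : Q, Submodule ℝ (TangentSpace 𝓘(ℝ, E) q))
    {Hor : Set (Q × Q)} {q₀ q₁ : Q} {r₁ : OrbitSpace G Q} (h : discreteLift Hor q₀ r₁ = q₁)
    (δ₀ δ₁ : EB) :
    checkF (EB := EB) EG L D Hor q₀ 1 r₁ δ₀ δ₁ =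
      verticalDeriv EG G L q₀ q₁ (dConnForm E EG G Hor q₀ q₁
        (horizontalLift (EB := EB) (G := G) D q₀ δ₀,
          horizontalLift (EB := EB) (G := G) D q₁ δ₁)) := by
  subst h
  dsimp only [checkF, checkL]
  -- The types of the tangent vectors depend on this point, so it is replaced by a variable before
  -- the factor `1` is removed.
  generalize hx : (1 : G) • discreteLift Hor q₀ r₁ = x
  rw [one_smul] at hx
  subst hx
  rfl

variable [ContMDiffSMul 𝓘(ℝ, EG) 𝓘(ℝ, E) ∞ G Q]

/-- Horizontal vectors project to the reduced variational constraints. -/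
theorem IsPrincipalBundle.mfderiv_proj_mem_breveD [IsManifold 𝓘(ℝ, E) ∞ Q]
    (hπ : IsPrincipalBundle E EG EB Q G) {S : DiscreteMechanicalSystem E Q}
    (hG : IsSymmetryGroup G S) {q : Q} {r : OrbitSpace G Q} (hr : proj G q = r) {v : E}
    (hv : v ∈ S.D q) :
    (mfderiv 𝓘(ℝ, E) 𝓘(ℝ, EB) (proj G) q : E →L[ℝ] EB) v ∈ breveD (EB := EB) S.D r := by
  -- `breveD` is computed at the representative `r.out`; the vector is carried there by $g$, which
  -- keeps it in $\mathcal D$ and does not change its projection.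
  obtain ⟨g, hg⟩ := proj_eq_proj_iff.1 (hr.trans (proj_out r).symm)
  have h₁ := hG.D_invariant g q v hv
  have h₂ := hπ.mfderiv_proj_smul g q v
  rw [← hg] at h₁ h₂
  exact ⟨_, h₁, h₂⟩

variable [LieGroup 𝓘(ℝ, EG) ∞ G]

theorem mdifferentiableAt_horProj {Hor : Set (Q × Q)}
    (hA : IsAffineDiscreteConnection E EG G Hor) {q₀ q₁ : Q} (h : (q₀, q₁) ∈ Hor) :
    MDifferentiableAt (𝓘(ℝ, E).prod 𝓘(ℝ, E)) (𝓘(ℝ, E).prod 𝓘(ℝ, E))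
      (horProj G Hor) (q₀, q₁) := by
  have hc := hA.smooth_connForm.contMDiffAt
    (hA.isOpen_formDomain.mem_nhds (mem_formDomain (G := G) h))
  exact (contMDiffAt_fst.prodMk (hc.inv.smul contMDiffAt_snd)).mdifferentiableAt (by simp)

/-- The representatives defining `breveL` need not vary continuously. Near the point, however,
invariance identifies it with $L\circ P\circ(s_0\times s_1)$ for local sections $s_i$ of $\pi$ and
$P$ = `horProj`. -/
theorem mdifferentiableAt_breveL (hπ : IsPrincipalBundle E EG EB Q G) {Hor : Set (Q × Q)}
    (hA : IsAffineDiscreteConnection E EG G Hor) {L : Q × Q → ℝ}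
    (hLs : ContMDiff (𝓘(ℝ, E).prod 𝓘(ℝ, E)) 𝓘(ℝ, ℝ) ∞ L)
    (hL : ∀ (g : G) (q₀ q₁ : Q), L (g • q₀, g • q₁) = L (q₀, q₁))
    {q₀ q₁ : Q} (h : (q₀, q₁) ∈ Hor) :
    MDifferentiableAt (𝓘(ℝ, EB).prod 𝓘(ℝ, EB)) 𝓘(ℝ, ℝ) (breveL L Hor)
      (proj G q₀, proj G q₁) := by
  obtain ⟨s₀, hs₀, he₀, hp₀⟩ := hπ.exists_section q₀
  obtain ⟨s₁, hs₁, he₁, hp₁⟩ := hπ.exists_section q₁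
  have hs : MDifferentiableAt (𝓘(ℝ, EB).prod 𝓘(ℝ, EB)) (𝓘(ℝ, E).prod 𝓘(ℝ, E))
      (Prod.map s₀ s₁) (proj G q₀, proj G q₁) := hs₀.prodMap hs₁
  have hse : Prod.map s₀ s₁ (proj G q₀, proj G q₁) = (q₀, q₁) := Prod.ext he₀ he₁
  have hLd : MDifferentiableAt (𝓘(ℝ, E).prod 𝓘(ℝ, E)) 𝓘(ℝ, ℝ) L (horProj G Hor (q₀, q₁)) :=
    (hLs _).mdifferentiableAt (by simp)
  have hc := (hLd.comp (q₀, q₁) (mdifferentiableAt_horProj hA h)).comp_of_eq _ hs hse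
  refine hc.congr_of_eventuallyEq ?_
  have hdom := hs.continuousAt.preimage_mem_nhds
    (hse ▸ hA.isOpen_formDomain.mem_nhds (mem_formDomain h))
  filter_upwards [hdom, hp₀.prod_nhds hp₁] with x hx hx'
  have := breveL_proj hA hL hx
  rw [Prod.map_fst, Prod.map_snd, hx'.1, hx'.2] at this
  exact this

/-- On horizontal pairs, `dL_d` is the pull-back of `dL̆_d` plus the vertical derivative of `L_d`
along `d𝒜_d`. -/
theorem dLagrangian_eq (hπ : IsPrincipalBundle E EG EB Q G) {Hor : Set (Q × Q)}
    (hA : IsAffineDiscreteConnection E EG G Hor) {L : Q × Q → ℝ}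
    (hLs : ContMDiff (𝓘(ℝ, E).prod 𝓘(ℝ, E)) 𝓘(ℝ, ℝ) ∞ L)
    (hL : ∀ (g : G) (q₀ q₁ : Q), L (g • q₀, g • q₁) = L (q₀, q₁))
    {q₀ q₁ : Q} (h : (q₀, q₁) ∈ Hor) (v₀ v₁ : E) :
    dLagrangian (E := E) L q₀ q₁ v₀ v₁ =
      dLagrangian (E := EB) (breveL L Hor) (proj G q₀) (proj G q₁)
        ((mfderiv 𝓘(ℝ, E) 𝓘(ℝ, EB) (proj G) q₀ : E →L[ℝ] EB) v₀)
        ((mfderiv 𝓘(ℝ, E) 𝓘(ℝ, EB) (proj G) q₁ : E →L[ℝ] EB) v₁) +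
      verticalDeriv EG G L q₀ q₁ (dConnForm E EG G Hor q₀ q₁ (v₀, v₁)) := by
  have hc := mdifferentiableAt_connForm hA h
  have hh := mdifferentiableAt_horProj hA h
  have hnhds := hA.isOpen_formDomain.mem_nhds (mem_formDomain (G := G) h)
  have hone := connForm_eq_one hA.unique h
  set A : Q × Q → G := fun p => connForm Hor p.1 p.2 with hAdef
  set C : G × (Q × Q) → ℝ := fun z => L (z.2.1, z.1 • z.2.2) with hC
  have hCs : MDifferentiableAt (𝓘(ℝ, EG).prod (𝓘(ℝ, E).prod 𝓘(ℝ, E))) 𝓘(ℝ, ℝ) C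
      (1, (q₀, q₁)) := by
    have : ContMDiff (𝓘(ℝ, EG).prod (𝓘(ℝ, E).prod 𝓘(ℝ, E))) 𝓘(ℝ, ℝ) ∞ C :=
      hLs.comp ((contMDiff_fst.comp contMDiff_snd).prodMk
        (contMDiff_fst.smul (contMDiff_snd.comp contMDiff_snd)))
    exact (this _).mdifferentiableAt (by simp)
  have hAH := hc.prodMk hh
  have heq : (A (q₀, q₁), horProj G Hor (q₀, q₁)) = (1, (q₀, q₁)) :=
    Prod.ext hone (horProj_eq hA h)
  -- This holds on all of $Q\times Q$, whatever value `connForm` takes outside its domain, because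
  -- $A$ and $A^{-1}$ cancel.
  have hfac : C ∘ (fun p => (A p, horProj G Hor p)) = L := by
    funext p
    simp [hC, horProj, hAdef]
  have h1 := mfderiv_comp_apply_of_eq (q₀, q₁) hCs hAH heq (v₀, v₁)
  rw [hfac, mfderiv_prodMk hc hh] at h1
  -- The partial derivative in $G$ gives the vertical term; the one in $Q\times Q$, with group
  -- variable $e$, gives $dL$ applied to the derivative of `horProj`.
  replace h1 := h1.trans (mfderiv_prod_eq_add_apply hCs)
  have hC1 : (fun z : Q × Q => C (1, z)) = L := by
    funext z
    simp [hC]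
  have hLd : MDifferentiableAt (𝓘(ℝ, E).prod 𝓘(ℝ, E)) 𝓘(ℝ, ℝ) L (q₀, q₁) :=
    (hLs _).mdifferentiableAt (by simp)
  have h2 := mfderiv_comp_apply_of_eq (q₀, q₁) hLd hh (horProj_eq hA h) (v₀, v₁)
  have hπ₀ := hπ.mdifferentiableAt_proj q₀
  have hπ₁ := hπ.mdifferentiableAt_proj q₁
  have hππ : MDifferentiableAt (𝓘(ℝ, E).prod 𝓘(ℝ, E)) (𝓘(ℝ, EB).prod 𝓘(ℝ, EB))
      (Prod.map (proj G) (proj G)) (q₀, q₁) := hπ₀.prodMap hπ₁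
  have h3 := mfderiv_comp_apply (q₀, q₁) (mdifferentiableAt_breveL hπ hA hLs hL h) hππ (v₀, v₁)
  have hev : (breveL L Hor ∘ Prod.map (proj G) (proj G)) =ᶠ[𝓝 (q₀, q₁)] L ∘ horProj G Hor := by
    filter_upwards [hnhds] with p hp using breveL_proj hA hL hp
  rw [hev.mfderiv_eq, mfderiv_prodMap (p := (q₀, q₁)) hπ₀ hπ₁] at h3
  replace h3 := h2.symm.trans h3
  refine h1.trans ((add_comm _ _).trans ?_)
  refine congrArg₂ (· + ·) ?_ rfl
  refine Eq.trans ?_ h3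
  dsimp only
  rw [hC1]
  rfl

/-- The differential of `L_d` on horizontal pairs and horizontal vectors in terms of the reduced
system. -/
theorem dLagrangian_eq_breve [IsManifold 𝓘(ℝ, E) ∞ Q] (hπ : IsPrincipalBundle E EG EB Q G)
    {S : DiscreteMechanicalSystem E Q} (hG : IsChaplyginSymmetryGroup EG G S)
    {q₀ q₁ : Q} (h : (q₀, q₁) ∈ S.Dd) {r₀ r₁ : OrbitSpace G Q} (h₀ : proj G q₀ = r₀)
    (h₁ : proj G q₁ = r₁) {v₀ v₁ : E} (hv₀ : v₀ ∈ S.D q₀) (hv₁ : v₁ ∈ S.D q₁) :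
    dLagrangian (E := E) S.L q₀ q₁ v₀ v₁ =
      dLagrangian (E := EB) (breveL S.L S.Dd) r₀ r₁
        ((mfderiv 𝓘(ℝ, E) 𝓘(ℝ, EB) (proj G) q₀ : E →L[ℝ] EB) v₀)
        ((mfderiv 𝓘(ℝ, E) 𝓘(ℝ, EB) (proj G) q₁ : E →L[ℝ] EB) v₁) +
      breveF (EB := EB) EG S.L S.D S.Dd r₀ r₁
        ((mfderiv 𝓘(ℝ, E) 𝓘(ℝ, EB) (proj G) q₀ : E →L[ℝ] EB) v₀)
        ((mfderiv 𝓘(ℝ, E) 𝓘(ℝ, EB) (proj G) q₁ : E →L[ℝ] EB) v₁) := by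
  subst h₀ h₁
  have hA := hG.discreteConnection
  -- The force is evaluated at $gq_0$, so the points and vectors are all translated by $g$. This
  -- changes neither $dL_d$ nor the projections.
  obtain ⟨g, hg⟩ := exists_out_rho_one (G := G) q₀
  have hgm := hA.invariant g _ _ h
  have hlift := discreteLift_eq hA.unique hgm
  rw [proj_smul] at hlift
  set w₀ : E := (mfderiv 𝓘(ℝ, E) 𝓘(ℝ, E) (fun x : Q => g • x) q₀ : E →L[ℝ] E) v₀
  set w₁ : E := (mfderiv 𝓘(ℝ, E) 𝓘(ℝ, E) (fun x : Q => g • x) q₁ : E →L[ℝ] E) v₁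
  have hw₀ : w₀ ∈ S.D (g • q₀) := hG.symmetry.D_invariant g q₀ v₀ hv₀
  have hw₁ : w₁ ∈ S.D (g • q₁) := hG.symmetry.D_invariant g q₁ v₁ hv₁
  have hp₀ := hπ.mfderiv_proj_smul g q₀ v₀
  have hp₁ := hπ.mfderiv_proj_smul g q₁ v₁
  have hl₀ := hπ.horizontalLift_eq (g • q₀) (hG.isCompl _) hw₀ hp₀
  have hl₁ := hπ.horizontalLift_eq (g • q₁) (hG.isCompl _) hw₁ hp₁
  have hd := dLagrangian_smul EG S.smooth_L hG.symmetry.L_invariant g q₀ q₁ v₀ v₁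
  have hkey := dLagrangian_eq hπ hA S.smooth_L hG.symmetry.L_invariant hgm w₀ w₁
  have hdL := dLagrangian_congr (E := EB) (breveL S.L S.Dd) (proj_smul g q₀) (proj_smul g q₁)
    hp₀ hp₁
  refine hd.symm.trans (hkey.trans (congrArg₂ (· + ·) hdL ?_))
  refine Eq.symm ?_
  simp only [breveF, hatF, inclusionY]
  rw [hg]
  refine (checkF_one S.L S.D hlift _ _).trans ?_
  exact congrArg₂ (fun a b : E => verticalDeriv EG G S.L (g • q₀) (g • q₁)
    (dConnForm E EG G S.Dd (g • q₀) (g • q₁) (a, b))) hl₀ hl₁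

end Reduction

end DiscreteReduction

/-! ### Lifting of reduced trajectories -/

theorem mainTheorem6 {E EG EB Q G : Type*}
    [NormedAddCommGroup E] [NormedSpace ℝ E] [FiniteDimensional ℝ E]
    [NormedAddCommGroup EG] [NormedSpace ℝ EG] [FiniteDimensional ℝ EG]
    [NormedAddCommGroup EB] [NormedSpace ℝ EB] [FiniteDimensional ℝ EB]
    [TopologicalSpace Q] [ChartedSpace E Q] [IsManifold 𝓘(ℝ, E) ∞ Q]
    [TopologicalSpace G] [ChartedSpace EG G] [Group G] [LieGroup 𝓘(ℝ, EG) ∞ G]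
    [MulAction G Q] [ContMDiffSMul 𝓘(ℝ, EG) 𝓘(ℝ, E) ∞ G Q]
    [ChartedSpace EB (DiscreteReduction.OrbitSpace G Q)]
    [IsManifold 𝓘(ℝ, EB) ∞ (DiscreteReduction.OrbitSpace G Q)]
    (hπ : DiscreteReduction.IsPrincipalBundle E EG EB Q G)
    (S : DiscreteReduction.DiscreteMechanicalSystem E Q)
    (hG : DiscreteReduction.IsChaplyginSymmetryGroup EG G S)
    (qbar₀ qbar₁ : Q) (hqbar : (qbar₀, qbar₁) ∈ S.Dd)
    (N : ℕ) (hN : 1 ≤ N) (r : Fin (N + 1) → DiscreteReduction.OrbitSpace G Q)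
    (hr : DiscreteReduction.IsForcedTrajectory (E := EB)
      (DiscreteReduction.breveL S.L S.Dd) (DiscreteReduction.breveD S.D)
      (DiscreteReduction.breveDd S.Dd) (DiscreteReduction.breveF EG S.L S.D S.Dd) r)
    (hr₀ : DiscreteReduction.proj G qbar₀ = r 0)
    (hr₁ : DiscreteReduction.proj G qbar₁ = r 1) :
    DiscreteReduction.IsTrajectory S.L S.D S.Dd
        (DiscreteReduction.liftedCurve S.Dd qbar₀ r) ∧
      DiscreteReduction.liftedCurve S.Dd qbar₀ r 0 = qbar₀ ∧
      DiscreteReduction.liftedCurve S.Dd qbar₀ r 1 = qbar₁ := by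

  have hA := hG.discreteConnection
  -- With $N=n+1$ the index `1` is the successor of `0`; in `Fin 1` it would coincide with `0`.
  obtain ⟨n, rfl⟩ : ∃ n, N = n + 1 := ⟨N - 1, by omega⟩
  have hproj := DiscreteReduction.proj_liftedCurve hA.invariant hA.unique hr₀ hr.1
  have hmem := DiscreteReduction.liftedCurve_mem hA.invariant hA.unique hr₀ hr.1
  set q := DiscreteReduction.liftedCurve S.Dd qbar₀ r with hq
  refine ⟨⟨hmem, fun δ hδ => ?_⟩, rfl, ?_⟩
  · have hδ' : DiscreteReduction.IsAdmissibleVariation (E := EB) (DiscreteReduction.breveD S.D) r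
        (fun k => (mfderiv 𝓘(ℝ, E) 𝓘(ℝ, EB) (DiscreteReduction.proj G) (q k) : E →L[ℝ] EB)
          (δ k)) := by
      refine ⟨?_, ?_, fun k => ?_⟩
      · exact (congrArg (mfderiv 𝓘(ℝ, E) 𝓘(ℝ, EB) (DiscreteReduction.proj G) (q 0) : E →L[ℝ] EB)
          hδ.1).trans (map_zero _)
      · exact (congrArg (mfderiv 𝓘(ℝ, E) 𝓘(ℝ, EB) (DiscreteReduction.proj G)
          (q (Fin.last _)) : E →L[ℝ] EB) hδ.2.1).trans (map_zero _)
      · exact hπ.mfderiv_proj_mem_breveD hG.symmetry (hproj k) (hδ.2.2 k)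
    have h := hr.2 _ hδ'
    refine (Finset.sum_congr rfl fun k _ => ?_).trans (Finset.sum_add_distrib.trans h)
    exact DiscreteReduction.dLagrangian_eq_breve hπ hG (hmem k) (hproj _) (hproj _) (hδ.2.2 _)
      (hδ.2.2 _)
  -- The first step of the recursion lifts $r_1=\pi(\bar q_1)$ from $\bar q_0$, and $(\bar q_0,\bar
  -- q_1)\in\mathcal D_d$ identifies the lift.
  · change DiscreteReduction.discreteLift S.Dd qbar₀ (r 1) = qbar₁
    rw [← hr₁, DiscreteReduction.discreteLift_eq hA.unique hqbar]
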